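/- Let $\mathbb{K}\in\{\mathbb{R},\mathbb{C}\}$, let $E$ and $F_n$ ($n\in\mathbb{N}=\{0,1,2,\dots\}$) be Hausdorff locally convex spaces over $\mathbb{K}$ with topological duals $E'$ and $F_n'$, and let $T_n:E\to F_n$ be continuous linear maps. Call $(T_n)_n$ \emph{Eidelheit} if for every $(y_n)_n\in\prod_{n\in\mathbb{N}}F_n$ there is $x\in E$ with $T_nx=y_n$ for all $n\in\mathbb{N}$. Call $E$ \emph{$B$-complete} if a linear subspace $X\subseteq E'$ is weak$^*$ closed if and only if, for every equicontinuous set $A\subseteq E'$, the set $X\cap A$ is closed in $A$ for the relative weak$^*$ topology. If $(T_n)_n$ is Eidelheit, then the following three properties hold. (P1) For every $N\in\mathbb{N}$ and all $y'_0\in F'_0,\dots,y'_N\in F'_N$, if $\sum_{n=0}^N y'_n\circ T_n=0$, then $y'_0=\dots=y'_N=0$. (P2) For every equicontinuous set $A\subseteq E'$ there is $\nu\in\mathbb{N}$ such that for every $N>\nu$ and all $y'_0\in F'_0,\dots,y'_N\in F'_N$, if $\sum_{n=0}^N y'_n\circ T_n\in A$, then $y'_{\nu+1}=\dots=y'_N=0$.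 (P3) For every $N\in\mathbb{N}$ the map $E\to\prod_{n=0}^N F_n$, $x\mapsto(T_0x,\dots,T_Nx)$, is surjective. Conversely, if $E$ is $B$-complete, every $F_n$ is barreled, and $(T_n)_n$ satisfies (P1), (P2) and (P3), then $(T_n)_n$ is Eidelheit. -/

import Mathlib

namespace Eidelheit

/-- `E` is `B`-complete (a Pták space): a linear subspace `X` of the dual `E'` is weak-* closed
if and only if, for every equicontinuous set `A ⊆ E'`, the set `X ∩ A` is closed in `A` for the
relative weak-* topology. -/
def IsBComplete (𝕜 E : Type*) [RCLike 𝕜] [AddCommGroup E] [Module 𝕜 E] [TopologicalSpace E] :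
    Prop :=
  ∀ X : Submodule 𝕜 (WeakDual 𝕜 E),
    IsClosed (X : Set (WeakDual 𝕜 E)) ↔
      ∀ A : Set (WeakDual 𝕜 E), Equicontinuous (fun (f : A) (x : E) => f.1 x) →
        IsClosed {f : A | f.1 ∈ X}

section

variable {𝕜 E : Type*} [RCLike 𝕜] [AddCommGroup E] [Module 𝕜 E] [TopologicalSpace E]
  {F : ℕ → Type*} [∀ n, AddCommGroup (F n)] [∀ n, Module 𝕜 (F n)]
  [∀ n, TopologicalSpace (F n)]

/-- `(T n)` is an Eidelheit sequence: for every choice of right-hand sides `y n ∈ F n` the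
infinite system `T n x = y n`, `n ∈ ℕ`, has a solution `x ∈ E`. -/
def IsEidelheit (T : ∀ n, E →L[𝕜] F n) : Prop :=
  ∀ y : ∀ n, F n, ∃ x : E, ∀ n, T n x = y n

/-- The functional `∑_{n=0}^N y'_n ∘ T_n` on `E`. -/
def transposeSum (T : ∀ n, E →L[𝕜] F n) (N : ℕ) (y' : ∀ n : Fin (N + 1), StrongDual 𝕜 (F n)) :
    StrongDual 𝕜 E :=
  ∑ n : Fin (N + 1), (y' n).comp (T n)

def P1 (T : ∀ n, E →L[𝕜] F n) : Prop :=
  ∀ (N : ℕ) (y' : ∀ n : Fin (N + 1), StrongDual 𝕜 (F n)),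
    transposeSum T N y' = 0 → ∀ n, y' n = 0

def P2 (T : ∀ n, E →L[𝕜] F n) : Prop :=
  ∀ A : Set (StrongDual 𝕜 E), Equicontinuous (fun (f : A) (x : E) => f.1 x) →
    ∃ ν : ℕ, ∀ N > ν, ∀ y' : ∀ n : Fin (N + 1), StrongDual 𝕜 (F n),
      transposeSum T N y' ∈ A → ∀ n : Fin (N + 1), ν < (n : ℕ) → y' n = 0

def P3 (T : ∀ n, E →L[𝕜] F n) : Prop :=
  ∀ N : ℕ, Function.Surjective (fun (x : E) (n : Fin (N + 1)) => T n x)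

end

end Eidelheit

open Filter Topology

namespace Eidelheit

section Duality

variable {𝕜 E : Type*} [RCLike 𝕜] [AddCommGroup E] [Module 𝕜 E] [TopologicalSpace E]

/-! Necessity of (P2): otherwise an equicontinuous set contains functionals whose top index `m` is
arbitrarily large. A triangular recursion gives `y` such that, at a solution `x`, these take the
values `m`, contradicting pointwise boundedness.

Sufficiency: let `X` consist of the finite sums `∑ d_n ∘ T_n` with `∑ d_n (y_n) = 0`. On
equicontinuous sets, (P2) bounds the length of the sums, (P3) makes the coefficients converge with
the functionals, and barrelledness keeps their limits continuous; so `B`-completeness makes `X`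
weak-* closed. For `y ≠ 0`, a point of `E` annihilated by `X` but not by a suitable `h₀ ∘ T_{n₀}`
solves the system after rescaling. -/

/-- An equicontinuous set of functionals is pointwise bounded. -/
theorem exists_norm_apply_le_of_equicontinuous [ContinuousSMul 𝕜 E] {A : Set (StrongDual 𝕜 E)}
    (hA : Equicontinuous (fun (f : A) (x : E) => f.1 x)) (x : E) :
    ∃ C : ℝ, ∀ f ∈ A, ‖f x‖ ≤ C := by
  have h1 : ∀ᶠ u in 𝓝 (0 : E), ∀ f : A, ‖f.1 u‖ < 1 := by
    simpa [dist_eq_norm] using Metric.equicontinuousAt_iff_right.1 (hA 0) 1 one_pos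
  have h2 : Tendsto (fun c : 𝕜 => c • x) (𝓝[≠] 0) (𝓝 0) := by
    have : Tendsto (fun c : 𝕜 => c • x) (𝓝 0) (𝓝 ((0 : 𝕜) • x)) :=
      (continuous_id.smul continuous_const).tendsto 0
    rw [zero_smul] at this
    exact this.mono_left nhdsWithin_le_nhds
  obtain ⟨c, hc, hc0⟩ := ((h2.eventually h1).and self_mem_nhdsWithin).exists
  have hc0 : 0 < ‖c‖ := norm_pos_iff.2 hc0
  refine ⟨‖c‖⁻¹, fun f hf => ?_⟩
  have := hc ⟨f, hf⟩
  simp only [map_smul, smul_eq_mul, norm_mul] at this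
  rw [← one_div, le_div_iff₀ hc0, mul_comm]
  exact this.le

/-- A point outside a weak-* closed subspace of the dual is separated from it by an evaluation. -/
theorem exists_eval_ne_zero_of_notMem {X : Submodule 𝕜 (WeakDual 𝕜 E)}
    (hX : IsClosed (X : Set (WeakDual 𝕜 E))) {f₀ : WeakDual 𝕜 E} (hf₀ : f₀ ∉ X) :
    ∃ x : E, f₀ x ≠ 0 ∧ ∀ f ∈ X, f x = 0 := by
  have h1 : (X : Set (WeakDual 𝕜 E))ᶜ ∈ 𝓝 f₀ := hX.isOpen_compl.mem_nhds hf₀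
  have h2 : 𝓝 f₀ = comap (fun (f : WeakDual 𝕜 E) (x : E) => f x) (𝓝 fun x => f₀ x) :=
    nhds_induced _ _
  rw [h2, mem_comap] at h1
  obtain ⟨t, ht, htX⟩ := h1
  rw [nhds_pi, mem_pi'] at ht
  obtain ⟨I, u, hu, hut⟩ := ht
  let Φ : WeakDual 𝕜 E →ₗ[𝕜] (I → 𝕜) :=
    { toFun := fun f i => f i.1
      map_add' := fun _ _ => rfl
      map_smul' := fun _ _ => rfl }
  -- The neighbourhood only tests the finitely many points of `I`, so the separation can be done in
  -- `𝕜^I`.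
  have h3 : Φ f₀ ∉ X.map Φ := by
    rintro ⟨g, hg, hgf⟩
    refine htX (hut fun i hi => ?_ : (fun x => g x) ∈ t) hg
    have : g i = f₀ i := congrFun hgf ⟨i, hi⟩
    change g i ∈ u i
    rw [this]
    exact mem_of_mem_nhds (hu i)
  obtain ⟨ψ, hψ, hψX⟩ := Submodule.exists_le_ker_of_notMem h3
  classical
  have key : ∀ f : WeakDual 𝕜 E, f (∑ i : I, ψ (Pi.single i 1) • i.1) = ψ (Φ f) := by
    intro f
    rw [LinearMap.pi_apply_eq_sum_univ ψ (Φ f), map_sum]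
    refine Finset.sum_congr rfl fun i _ => ?_
    rw [map_smul, smul_eq_mul, smul_eq_mul, mul_comm]
    congr 2
    ext j
    simp [Pi.single_apply, eq_comm]
  refine ⟨_, by rw [key]; exact hψ, fun f hf => ?_⟩
  rw [key]
  exact hψX ⟨f, hf, rfl⟩

/-- In a barrelled space the pointwise limit, along any filter, of a pointwise bounded family of
continuous functionals is a continuous functional. -/
theorem exists_strongDual_tendsto [IsTopologicalAddGroup E] [ContinuousSMul 𝕜 E]
    [BarrelledSpace 𝕜 E] {ι : Type*} {l : Filter ι} [l.NeBot] (φ : ι → StrongDual 𝕜 E)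
    (hb : ∀ y, ∃ C : ℝ, ∀ i, ‖φ i y‖ ≤ C) (hl : ∀ y, ∃ z, Tendsto (fun i => φ i y) l (𝓝 z)) :
    ∃ h : StrongDual 𝕜 E, ∀ y, Tendsto (fun i => φ i y) l (𝓝 (h y)) := by
  let := IsTopologicalAddGroup.rightUniformSpace E
  have : IsUniformAddGroup E := isUniformAddGroup_of_addCommGroup
  choose z hz using hl
  have hz' : Tendsto (fun i y => φ i y) l (𝓝 z) := tendsto_pi_nhds.2 hz
  have heq : UniformEquicontinuous ((↑) ∘ φ : ι → E → 𝕜) := by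
    refine (norm_withSeminorms 𝕜 𝕜).banach_steinhaus fun _ y => ?_
    obtain ⟨C, hC⟩ := hb y
    exact ⟨C, by rintro _ ⟨i, rfl⟩; exact hC i⟩
  have hcont : Continuous z := hz'.continuous_of_equicontinuous heq.equicontinuous
  exact ⟨⟨linearMapOfTendsto z (fun i => (φ i).toLinearMap) hz', hcont⟩, hz⟩

theorem separatingDual_of_locallyConvexSpace [Module ℝ E] [IsScalarTower ℝ 𝕜 E]
    [IsTopologicalAddGroup E] [ContinuousSMul 𝕜 E] [LocallyConvexSpace ℝ E] [T2Space E] :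
    SeparatingDual 𝕜 E :=
  ⟨fun _ hx => (RCLike.geometric_hahn_banach_point_point (𝕜 := 𝕜) hx).imp
    fun f hf hf' => by simp [hf'] at hf⟩

end Duality

section Sequences

/-- Dependent sequences can be defined by course-of-values recursion. -/
theorem exists_seq_of_step {F : ℕ → Type*} [∀ n, Zero (F n)]
    (G : ∀ m, (∀ n, F n) → F m) :
    ∃ y : ∀ n, F n, ∀ m, y m = G m fun n => if n < m then y n else 0 := by
  let step : ∀ m, (∀ n, n < m → F n) → F m := fun m ih =>
    G m fun n => if h : n < m then ih n h else 0
  refine ⟨wellFounded_lt.fix step, fun m => ?_⟩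
  rw [WellFounded.fix_eq]
  simp [step]

variable {𝕜 E : Type*} [RCLike 𝕜] [AddCommGroup E] [Module 𝕜 E] [TopologicalSpace E]
  {F : ℕ → Type*} [∀ n, AddCommGroup (F n)] [∀ n, Module 𝕜 (F n)]
  [∀ n, TopologicalSpace (F n)] {T : ∀ n, E →L[𝕜] F n}

theorem transposeSum_apply (N : ℕ) (y' : ∀ n : Fin (N + 1), StrongDual 𝕜 (F n)) (x : E) :
    transposeSum T N y' x = ∑ n : Fin (N + 1), y' n (T n x) := by
  simp [transposeSum]

theorem transposeSum_apply_eq_sum_range (N : ℕ) (d : ∀ n, StrongDual 𝕜 (F n)) (x : E) :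
    transposeSum T N (fun n => d n) x = ∑ n ∈ Finset.range (N + 1), d n (T n x) := by
  rw [transposeSum_apply]
  exact Fin.sum_univ_eq_sum_range (fun n => d n (T n x)) (N + 1)

theorem P3.exists_eq (h : P3 T) (N : ℕ) (y : ∀ n, F n) : ∃ x, ∀ n ≤ N, T n x = y n := by
  obtain ⟨x, hx⟩ := h N fun n => y n
  exact ⟨x, fun n hn => congrFun hx ⟨n, Nat.lt_succ_of_le hn⟩⟩

/-- Test the sum on an `x` with `T n x = z` and all other `T m x = 0`. -/
theorem P3.P1 (h : P3 T) : P1 T := by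
  intro N y' h0 n
  ext z
  obtain ⟨x, hx⟩ := h N (Pi.single n z)
  have h1 := transposeSum_apply (T := T) N y' x
  rw [h0, Finset.sum_eq_single n] at h1
  · have h2 : T n x = z := by simpa using congrFun hx n
    rw [← h2, ← h1]
    rfl
  · intro m _ hm
    have h2 : T m x = 0 := by simpa [hm] using congrFun hx m
    rw [h2, map_zero]
  · simp

theorem IsEidelheit.P3 (h : IsEidelheit T) : P3 T := by
  intro N y
  obtain ⟨x, hx⟩ := h fun n => if hn : n < N + 1 then y ⟨n, hn⟩ else 0
  refine ⟨x, funext fun n => ?_⟩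
  exact (hx n).trans (dif_pos n.2)

/-- If `d m` is nonzero for every `m` in a set `I`, then the triangular system
`∑_{n ≤ m} (d m) n (y n) = m`, `m ∈ I`, has a solution. -/
theorem exists_sum_range_eq (I : Set ℕ) (d : ℕ → ∀ n, StrongDual 𝕜 (F n))
    (hd : ∀ m ∈ I, d m m ≠ 0) :
    ∃ y : ∀ n, F n, ∀ m ∈ I, ∑ n ∈ Finset.range (m + 1), d m n (y n) = (m : 𝕜) := by
  have hG : ∀ (m : ℕ) (z : ∀ n, F n), ∃ w : F m, m ∈ I →
      ∑ n ∈ Finset.range m, d m n (z n) + d m m w = (m : 𝕜) := by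
    intro m z
    by_cases hm : m ∈ I
    · obtain ⟨v, hv⟩ : ∃ v, d m m v ≠ 0 := by
        by_contra! h
        exact hd m hm (ContinuousLinearMap.ext h)
      refine ⟨(((m : 𝕜) - ∑ n ∈ Finset.range m, d m n (z n)) / d m m v) • v, fun _ => ?_⟩
      rw [map_smul, smul_eq_mul, div_mul_cancel₀ _ hv]
      ring
    · exact ⟨0, fun h => absurd h hm⟩
  choose G hG using hG
  obtain ⟨y, hy⟩ := exists_seq_of_step G
  refine ⟨y, fun m hm => ?_⟩
  rw [Finset.sum_range_succ, ← hG m (fun n => if n < m then y n else 0) hm, ← hy m]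
  congr 1
  refine Finset.sum_congr rfl fun n hn => ?_
  simp [Finset.mem_range.1 hn]

/-- A functional `∑_{n ≤ N} y'_n ∘ T_n` can be written with its last nonzero coefficient on top. -/
theorem exists_top_coeff {N ν : ℕ} {y' : ∀ n : Fin (N + 1), StrongDual 𝕜 (F n)}
    {n : Fin (N + 1)} (hn : ν < n) (h0 : y' n ≠ 0) :
    ∃ m > ν, ∃ d : ∀ n, StrongDual 𝕜 (F n), d m ≠ 0 ∧
      ∀ x, transposeSum T N y' x = ∑ n ∈ Finset.range (m + 1), d n (T n x) := by
  classical
  let d : ∀ n, StrongDual 𝕜 (F n) := fun n => if hn : n < N + 1 then y' ⟨n, hn⟩ else 0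
  have hd : ∀ i : Fin (N + 1), d i = y' i := fun i => dif_pos i.2
  have hy : y' = fun i : Fin (N + 1) => d i := funext fun i => (hd i).symm
  have hnN : (n : ℕ) ≤ N := Nat.le_of_lt_succ n.2
  have hdn : d n ≠ 0 := by rwa [hd]
  refine ⟨Nat.findGreatest (fun k => d k ≠ 0) N,
    hn.trans_le (Nat.le_findGreatest hnN hdn), d,
    Nat.findGreatest_spec (P := fun k => d k ≠ 0) hnN hdn, fun x => ?_⟩
  rw [hy, transposeSum_apply_eq_sum_range]
  symm
  refine Finset.sum_subset (Finset.range_subset_range.2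
    (Nat.succ_le_succ (Nat.findGreatest_le N))) fun k hk hk' => ?_
  have : d k = 0 := by
    by_contra h
    exact hk' (Finset.mem_range.2 (Nat.lt_succ_of_le (Nat.le_findGreatest
      (Nat.le_of_lt_succ (Finset.mem_range.1 hk)) h)))
  rw [this]
  rfl

theorem IsEidelheit.P2 [ContinuousSMul 𝕜 E] (h : IsEidelheit T) : P2 T := by
  intro A hA
  by_contra! hcon
  let I : Set ℕ := {m | ∃ d : ∀ n, StrongDual 𝕜 (F n), d m ≠ 0 ∧
    ∃ f ∈ A, ∀ x, f x = ∑ n ∈ Finset.range (m + 1), d n (T n x)}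
  have hI : ∀ ν : ℕ, ∃ m > ν, m ∈ I := by
    intro ν
    obtain ⟨N, -, y', hy', n, hn, hn0⟩ := hcon ν
    obtain ⟨m, hm, d, hd, hsum⟩ := exists_top_coeff (T := T) hn hn0
    exact ⟨m, hm, d, hd, _, hy', hsum⟩
  have hd : ∀ m, ∃ d : ∀ n, StrongDual 𝕜 (F n), m ∈ I → d m ≠ 0 ∧
      ∃ f ∈ A, ∀ x, f x = ∑ n ∈ Finset.range (m + 1), d n (T n x) := by
    intro m
    by_cases hm : m ∈ I
    · exact hm.imp fun _ hd _ => hd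
    · exact ⟨0, fun h => absurd h hm⟩
  choose d hd using hd
  obtain ⟨y, hy⟩ := exists_sum_range_eq I d fun m hm => (hd m hm).1
  obtain ⟨x, hx⟩ := h y
  obtain ⟨C, hC⟩ := exists_norm_apply_le_of_equicontinuous hA x
  obtain ⟨k, hk⟩ := exists_nat_gt C
  obtain ⟨m, hkm, hm⟩ := hI k
  obtain ⟨-, f, hf, hfx⟩ := hd m hm
  have h1 : f x = (m : 𝕜) := by
    rw [hfx, ← hy m hm]
    exact Finset.sum_congr rfl fun n _ => by rw [hx]
  have h2 := hC f hf
  rw [h1, RCLike.norm_natCast] at h2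
  have h3 : (k : ℝ) < m := by exact_mod_cast hkm
  linarith

/-- The functionals `∑ d_n ∘ T_n` (finite sums) with `∑ d_n (y_n) = 0`. -/
def annihilatorImage (T : ∀ n, E →L[𝕜] F n) (y : ∀ n, F n) : Submodule 𝕜 (WeakDual 𝕜 E) where
  carrier := {f | ∃ d : ∀ n, StrongDual 𝕜 (F n), ∀ᶠ M in atTop,
    (∀ x, f x = ∑ n ∈ Finset.range M, d n (T n x)) ∧ ∑ n ∈ Finset.range M, d n (y n) = 0}
  zero_mem' := ⟨0, Eventually.of_forall fun M => ⟨fun x => (by simp : (0 : 𝕜) = _), by simp⟩⟩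
  add_mem' := by
    rintro f g ⟨d, hd⟩ ⟨e, he⟩
    refine ⟨d + e, ?_⟩
    filter_upwards [hd, he] with M hd he
    refine ⟨fun x => ?_, ?_⟩
    · change f x + g x = _
      simp [Finset.sum_add_distrib, ← hd.1, ← he.1]
    · simp [Finset.sum_add_distrib, hd.2, he.2]
  smul_mem' := by
    rintro c f ⟨d, hd⟩
    refine ⟨c • d, ?_⟩
    filter_upwards [hd] with M hd
    refine ⟨fun x => ?_, ?_⟩
    · change c • f x = _
      simp [← Finset.mul_sum, ← hd.1]
    · simp [← Finset.mul_sum, hd.2]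

theorem sum_range_single {M n : ℕ} (hn : n < M) (k : StrongDual 𝕜 (F n)) (z : ∀ n, F n) :
    ∑ m ∈ Finset.range M, (Pi.single n k : ∀ n, StrongDual 𝕜 (F n)) m (z m) = k (z n) := by
  rw [Finset.sum_eq_single n]
  · simp
  · intro m _ hm
    simp [hm]
  · intro h
    exact absurd (Finset.mem_range.2 hn) h

/-- Under `P2`, the elements of an equicontinuous set have representations of bounded length. -/
theorem P2.exists_bound (h2 : P2 T) {A : Set (WeakDual 𝕜 E)}
    (hA : Equicontinuous (fun (f : A) (x : E) => f.1 x)) :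
    ∃ ν : ℕ, ∀ f ∈ A, ∀ d : ∀ n, StrongDual 𝕜 (F n),
      (∀ᶠ M in atTop, ∀ x, f x = ∑ n ∈ Finset.range M, d n (T n x)) → ∀ n > ν, d n = 0 := by
  obtain ⟨ν, hν⟩ := h2 A hA
  refine ⟨ν, fun f hf d hd n hn => ?_⟩
  -- The shift by one is there because `transposeSum T M` has `M + 1` terms.
  obtain ⟨M, hM, hnM⟩ := (((tendsto_add_atTop_nat 1).eventually hd).and
    (eventually_ge_atTop n)).exists
  have hsum : transposeSum T M (fun n => d n) = f := by
    refine ContinuousLinearMap.ext fun x => ?_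
    rw [transposeSum_apply_eq_sum_range]
    exact (hM x).symm
  exact hν M (hn.trans_le hnM) (fun n => d n) (hsum ▸ hf) ⟨n, Nat.lt_succ_of_le hnM⟩ hn

theorem sum_range_eq_of_le {ν M : ℕ} (hM : ν + 1 ≤ M) {d : ∀ n, StrongDual 𝕜 (F n)}
    (hd : ∀ n > ν, d n = 0) (z : ∀ n, F n) :
    ∑ n ∈ Finset.range M, d n (z n) = ∑ n ∈ Finset.range (ν + 1), d n (z n) := by
  symm
  refine Finset.sum_subset (Finset.range_subset_range.2 hM) fun n _ hn => ?_
  rw [hd n (by simpa using hn)]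
  rfl

theorem isClosed_annihilatorImage_inter [ContinuousSMul 𝕜 E]
    [∀ n, IsTopologicalAddGroup (F n)] [∀ n, ContinuousSMul 𝕜 (F n)]
    [∀ n, BarrelledSpace 𝕜 (F n)] (h2 : P2 T) (h3 : P3 T) (y : ∀ n, F n)
    {A : Set (WeakDual 𝕜 E)} (hA : Equicontinuous (fun (f : A) (x : E) => f.1 x)) :
    IsClosed {f : A | f.1 ∈ annihilatorImage T y} := by
  obtain ⟨ν, hν⟩ := h2.exists_bound hA
  refine isClosed_of_closure_subset fun g hg => ?_
  set S : Set A := {f : A | f.1 ∈ annihilatorImage T y} with hS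
  have : NeBot (comap ((↑) : S → A) (𝓝 g)) := mem_closure_iff_comap_neBot.1 hg
  set l := comap ((↑) : S → A) (𝓝 g) with hl
  have hlim : ∀ x : E, Tendsto (fun f : S => f.1.1 x) l (𝓝 (g.1 x)) := fun x =>
    ((WeakDual.eval_continuous x).comp continuous_subtype_val).continuousAt.tendsto.comp
      tendsto_comap
  have hrep : ∀ f : S, ∃ d : ∀ n, StrongDual 𝕜 (F n), (∀ n > ν, d n = 0) ∧
      (∀ x, f.1.1 x = ∑ n ∈ Finset.range (ν + 1), d n (T n x)) ∧
      ∑ n ∈ Finset.range (ν + 1), d n (y n) = 0 := by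
    rintro ⟨f, d, hd⟩
    have hd0 := hν f.1 f.2 d (hd.mono fun _ h => h.1)
    obtain ⟨M, hM, hνM⟩ := (hd.and (eventually_ge_atTop (ν + 1))).exists
    refine ⟨d, hd0, fun x => ?_, ?_⟩
    · rw [← sum_range_eq_of_le hνM hd0 fun n => T n x]
      exact hM.1 x
    · rw [← sum_range_eq_of_le hνM hd0]
      exact hM.2
  choose d hd0 hdT hdy using hrep
  -- Solving for `z` in position `n` and zero elsewhere up to `ν` turns each coefficient into
  -- evaluation at a point `x` independent of `f`.
  have hcoeff : ∀ n, ∀ z : F n, (∀ f, d f n z = 0) ∨ ∃ x, ∀ f : S, d f n z = f.1.1 x := by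
    intro n z
    rcases le_or_gt n ν with hn | hn
    · obtain ⟨x, hx⟩ := h3.exists_eq ν (Pi.single n z)
      refine Or.inr ⟨x, fun f => ?_⟩
      rw [hdT f x, Finset.sum_eq_single n]
      · rw [hx n hn, Pi.single_eq_same]
      · intro m hm hmn
        rw [hx m (Nat.le_of_lt_succ (Finset.mem_range.1 hm)), Pi.single_eq_of_ne hmn, map_zero]
      · intro h
        exact absurd (Finset.mem_range.2 (Nat.lt_succ_of_le hn)) h
    · exact Or.inl fun f => by rw [hd0 f n hn]; rfl
  have hh : ∀ n, ∃ h : StrongDual 𝕜 (F n), ∀ z, Tendsto (fun f => d f n z) l (𝓝 (h z)) := by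
    refine fun n => exists_strongDual_tendsto (fun f => d f n) (fun z => ?_) fun z => ?_
    · rcases hcoeff n z with h | ⟨x, hx⟩
      · exact ⟨0, fun f => by simp [h]⟩
      · obtain ⟨C, hC⟩ := exists_norm_apply_le_of_equicontinuous (A := A) hA x
        exact ⟨C, fun f => by rw [hx]; exact hC f.1.1 f.1.2⟩
    · rcases hcoeff n z with h | ⟨x, hx⟩
      · exact ⟨0, by simp [h]⟩
      · exact ⟨g.1 x, by simpa only [hx] using hlim x⟩
  choose h hh using hh
  have hh0 : ∀ n > ν, h n = 0 := by
    intro n hn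
    ext z
    refine tendsto_nhds_unique (hh n z) ?_
    simp [hd0 _ n hn]
  have hsum : ∀ z : ∀ n, F n, Tendsto (fun f => ∑ n ∈ Finset.range (ν + 1), d f n (z n)) l
      (𝓝 (∑ n ∈ Finset.range (ν + 1), h n (z n))) :=
    fun z => tendsto_finsetSum _ fun n _ => hh n (z n)
  refine ⟨h, (eventually_ge_atTop (ν + 1)).mono fun M hM => ⟨fun x => ?_, ?_⟩⟩
  · rw [sum_range_eq_of_le hM hh0 fun n => T n x]
    refine tendsto_nhds_unique (hlim x) ?_
    simpa only [hdT] using hsum fun n => T n x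
  · rw [sum_range_eq_of_le hM hh0]
    refine tendsto_nhds_unique (hsum y) ?_
    simp [hdy]

/-- If the subspaces `annihilatorImage T y` are weak-* closed, the system is solvable. -/
theorem exists_solution_of_isClosed [∀ n, SeparatingDual 𝕜 (F n)] (h3 : P3 T) (y : ∀ n, F n)
    (hX : IsClosed (annihilatorImage T y : Set (WeakDual 𝕜 E))) : ∃ x, ∀ n, T n x = y n := by
  by_cases hy : ∀ n, y n = 0
  · exact ⟨0, fun n => by rw [hy, map_zero]⟩
  push Not at hy
  obtain ⟨n₀, hn₀⟩ := hy
  obtain ⟨h₀, hh₀⟩ := SeparatingDual.exists_ne_zero (R := 𝕜) hn₀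
  -- Otherwise, evaluating at a solution of the first `M + 1` equations gives `h₀ (y n₀) = ∑ d n (y
  -- n) = 0`.
  have hf₀ : (h₀.comp (T n₀) : WeakDual 𝕜 E) ∉ annihilatorImage T y := by
    rintro ⟨d, hd⟩
    obtain ⟨M, hM, hnM⟩ := (hd.and (eventually_ge_atTop n₀)).exists
    obtain ⟨x, hx⟩ := h3.exists_eq M y
    apply hh₀
    rw [← hx n₀ hnM, ← hM.2]
    refine (hM.1 x).trans (Finset.sum_congr rfl fun n hn => ?_)
    rw [hx n (Finset.mem_range.1 hn).le]
  obtain ⟨x, hx₀, hx⟩ := exists_eval_ne_zero_of_notMem hX hf₀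
  change h₀ (T n₀ x) ≠ 0 at hx₀
  -- The factor is forced by the equation for `n₀` tested against `h₀`.
  refine ⟨(h₀ (y n₀) / h₀ (T n₀ x)) • x, fun n => ?_⟩
  by_contra hne
  obtain ⟨k, hk⟩ := SeparatingDual.exists_separating_of_ne (R := 𝕜) hne
  apply hk
  -- This combination is chosen to cancel on `y`; its vanishing at `x` is the `n`-th equation tested
  -- against `k`.
  have hmem : ((h₀ (y n₀) • k).comp (T n) - (k (y n) • h₀).comp (T n₀) : StrongDual 𝕜 E) ∈
      annihilatorImage T y := by
    refine ⟨Pi.single n (h₀ (y n₀) • k) - Pi.single n₀ (k (y n) • h₀), ?_⟩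
    filter_upwards [eventually_gt_atTop n, eventually_gt_atTop n₀] with M hM hM₀
    have key : ∀ z : ∀ n, F n, ∑ m ∈ Finset.range M, (Pi.single n (h₀ (y n₀) • k) -
        Pi.single n₀ (k (y n) • h₀) : ∀ n, StrongDual 𝕜 (F n)) m (z m) =
        h₀ (y n₀) * k (z n) - k (y n) * h₀ (z n₀) := by
      intro z
      simp only [Pi.sub_apply, _root_.sub_apply, Finset.sum_sub_distrib]
      rw [sum_range_single hM, sum_range_single hM₀]
      rfl
    refine ⟨fun x => ?_, ?_⟩
    · rw [key fun n => T n x]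
      rfl
    · rw [key]
      ring
  have h1 : h₀ (y n₀) * k (T n x) - k (y n) * h₀ (T n₀ x) = 0 := hx _ hmem
  rw [map_smul, map_smul, smul_eq_mul, div_mul_eq_mul_div, div_eq_iff hx₀]
  exact sub_eq_zero.1 h1

end Sequences

end Eidelheit

theorem theorem3p1 {𝕜 E : Type*} [RCLike 𝕜]
    [AddCommGroup E] [Module 𝕜 E] [Module ℝ E] [IsScalarTower ℝ 𝕜 E]
    [TopologicalSpace E] [IsTopologicalAddGroup E] [ContinuousSMul 𝕜 E]
    [LocallyConvexSpace ℝ E] [T2Space E]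
    {F : ℕ → Type*} [∀ n, AddCommGroup (F n)] [∀ n, Module 𝕜 (F n)] [∀ n, Module ℝ (F n)]
    [∀ n, IsScalarTower ℝ 𝕜 (F n)] [∀ n, TopologicalSpace (F n)]
    [∀ n, IsTopologicalAddGroup (F n)] [∀ n, ContinuousSMul 𝕜 (F n)]
    [∀ n, LocallyConvexSpace ℝ (F n)] [∀ n, T2Space (F n)]
    (T : ∀ n, E →L[𝕜] F n) :
    (Eidelheit.IsEidelheit T → Eidelheit.P1 T ∧ Eidelheit.P2 T ∧ Eidelheit.P3 T) ∧
    (Eidelheit.IsBComplete 𝕜 E → (∀ n, BarrelledSpace 𝕜 (F n)) →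
      Eidelheit.P1 T → Eidelheit.P2 T → Eidelheit.P3 T → Eidelheit.IsEidelheit T) := by
  refine ⟨fun h => ⟨h.P3.P1, h.P2, h.P3⟩, fun hE hF _ h2 h3 y => ?_⟩
  have : ∀ n, SeparatingDual 𝕜 (F n) := fun n =>
    Eidelheit.separatingDual_of_locallyConvexSpace
  exact Eidelheit.exists_solution_of_isClosed h3 y
    ((hE _).2 fun A hA => Eidelheit.isClosed_annihilatorImage_inter h2 h3 y hA)
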